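/- For $n\ge 0$ and $s=(s^0,\dots,s^n)\in\mathbb{R}^{n+1}$ with $s^0>0$ let $X_n(s)=(s^1/s^0,\dots,s^n/s^0)\in\mathbb{R}^n$ be the perspective function. Let $d,d'\ge 0$, and let $D\subset\mathbb{R}^{d+1}$ and $D'\subset\mathbb{R}^{d'+1}$ each be either the half-space $\{s: s^0>0\}$ or the open orthant $\{s: s^i>0\ \forall i\}$ of the respective space. Write $X=X_d|_D$, $X'=X_{d'}|_{D'}$. A map $g$ from $D$ to a real vector space satisfies the scalar condition if for all $s\in D$ and $\lambda>0$ there is $\mu_{\lambda,s}>0$ with $g(\lambda s)=\mu_{\lambda,s}\,g(s)$. A map $f:D\to D'$ induces $F:X(D)\to X'(D')$ if $F(X(s))=X'(f(s))$ for all $s\in D$. A map $g$ from a nonempty convex set $C$ to a real vector space is strict inversely convexity preserving if $g((x,y))\subseteq(g(x),g(y))$ for all $x,y\in C$, where $(x,y)=\{tx+(1-t)y:0<t<1\}$. Let $f=(f^0,\dots,f^{d'}):D\to D'$. (1) Suppose that $f$ satisfies the scalar condition and induces a strict inversely convexity preserving map $F:X(D)\to X'(D')\subset\mathbb{R}^{d'}$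 whose image contains three non-collinear points (that is, is not contained in a straight line). Then there is a linear map $L=(L^0,\dots,L^{d'}):\mathbb{R}^{d+1}\to\mathbb{R}^{d'+1}$ such that $$f(s)=\frac{f^0(s)}{L^0(s)}\,L(s)\qquad (s\in D),$$ $f^0$ satisfies the scalar condition, and $f^0>0$ and $L^0>0$ on $D$ (that is, on $s^0>0$ when $D$ is the half-space). (2) Conversely, if there is a linear map $L$ such that $f$ has this form, $f^0$ satisfies the scalar condition, and $f^0>0$, $L^0>0$ on $D$, then $f$ induces a strict inversely convexity preserving map $F:X(D)\to X'(D')$. -/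

import Mathlib

/-- The perspective function `X : ℝ^{d+1} → ℝ^d`, `X(s) = (s¹/s⁰, …, s^d/s⁰)`; it is only ever
used on sets where `s⁰ > 0`. -/
noncomputable def perspective {d : ℕ} (s : Fin (d + 1) → ℝ) : Fin d → ℝ :=
  fun i => s i.succ / s 0

/-- The domains on which the perspective function is considered: the half-space `s⁰ > 0`, or the
open positive orthant. -/
def IsPerspectiveDomain {d : ℕ} (D : Set (Fin (d + 1) → ℝ)) : Prop :=
  D = {s | 0 < s 0} ∨ D = {s | ∀ i, 0 < s i}

/-- The scalar condition on a map `g` defined on `D`: for all `s` and `r > 0` there is `μ > 0`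
(depending on `r` and `s`) with `g (r s) = μ g(s)`. -/
def ScalarCondition {V W : Type*} [SMul ℝ V] [SMul ℝ W] {D : Set V} (g : D → W) : Prop :=
  ∀ (s t : D) (r : ℝ), 0 < r → (t : V) = r • (s : V) → ∃ μ : ℝ, 0 < μ ∧ g t = μ • g s

/-- `g : C → W` is strict inversely convexity preserving: `g((x,y)) ⊆ (g(x),g(y))` for all
`x, y ∈ C`, where `(x,y) = {t x + (1-t) y : 0 < t < 1}` (so `(x,x) = {x}`). -/
def StrictInvConvexityPreserving {V W : Type*} [AddCommGroup V] [Module ℝ V]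
    [AddCommGroup W] [Module ℝ W] {C : Set V} (g : C → W) : Prop :=
  ∀ x y z : C, (z : V) ∈ openSegment ℝ (x : V) (y : V) → g z ∈ openSegment ℝ (g x) (g y)

/-- `f : dom X → dom X'` induces `F : Im X → Im X'`: `F(X(s)) = X'(f(s))` for all `s ∈ dom X`. -/
def Induces {d d' : ℕ} {D : Set (Fin (d + 1) → ℝ)} {D' : Set (Fin (d' + 1) → ℝ)}
    (f : D → D') (F : perspective '' D → perspective '' D') : Prop :=
  ∀ s : D, (F ⟨perspective s, Set.mem_image_of_mem perspective s.2⟩ : Fin d' → ℝ) =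
    perspective (f s : Fin (d' + 1) → ℝ)

/-- `f(s) = (f⁰(s)/L⁰(s)) L(s)` with `L` linear, `f⁰` (the first coordinate of `f`) satisfying the
scalar condition, and `f⁰, L⁰ > 0` on the domain. -/
def HasFractionalForm {d d' : ℕ} {D : Set (Fin (d + 1) → ℝ)} {D' : Set (Fin (d' + 1) → ℝ)}
    (f : D → D') : Prop :=
  ∃ L : (Fin (d + 1) → ℝ) →ₗ[ℝ] (Fin (d' + 1) → ℝ),
    ScalarCondition (fun s : D => (f s : Fin (d' + 1) → ℝ) 0) ∧
    (∀ s : D, 0 < (f s : Fin (d' + 1) → ℝ) 0) ∧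
    (∀ s : D, 0 < L s 0) ∧
    ∀ s : D, (f s : Fin (d' + 1) → ℝ) = ((f s : Fin (d' + 1) → ℝ) 0 / L s 0) • L s

/-!
Part (1) is the additive form of the fundamental theorem of projective geometry, carried out on a
convex cone. Set `p s = F (X s)`. Since `X (s + t)` lies strictly between `X s` and `X t`, the point
`p (s + t)` is a strict convex combination of `p s` and `p t`; let `m s t > 0` be the ratio of the
weight of `p t` to that of `p s`. This ratio is unique when `p s ≠ p t`. If `p s`, `p t`, `p u` are
not collinear, comparing the barycentric coordinates of `p (s + t + u)` obtained from the different
bracketings gives `m s t * m t u = m s u` and `m s (t + u) = m s t + m s u`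
(`IsWeightRatio.mul_eq_and_add_eq`). Since the image is not collinear, an auxiliary point off the
relevant line extends the first identity to all triples with distinct images
(`IsWeightRatio.mul_eq`), so `m s t = c t / c s` for a positive function `c`
(`IsWeightRatio.exists_potential`); the second identity makes `c` additive
(`IsWeightRatio.exists_additive_weight`).

A positive additive function on a cone is positively homogeneous (`eq_mul_of_pos_of_add`), so
`s ↦ c s • (1, p s)` is additive and positively homogeneous, and it extends to a linear map `L` of
the whole space (`exists_linear_extension`). Its zeroth coordinate on the domain is `c`, and
`f s` is a multiple of `(1, p s)`, which is the required form.

Part (2): a linear map sends an open segment to an open segment, and the perspective function sends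
`s + t` strictly between the images of `s` and `t` and ignores positive factors.
-/

/-! ### Non-collinear points -/

/-- Barycentric coordinates with respect to three non-collinear points are unique. -/
theorem eq_of_weights_eq {W : Type*} [AddCommGroup W] [Module ℝ W] {x y z : W}
    (h : ¬ Collinear ℝ {x, y, z}) {a b c a' b' c' : ℝ} (hs : a + b + c = 1)
    (hs' : a' + b' + c' = 1)
    (he : a • x + b • y + c • z = a' • x + b' • y + c' • z) : a = a' ∧ b = b' ∧ c = c' := by
  rw [← affineIndependent_iff_not_collinear_set, affineIndependent_iff] at h
  have key := h Finset.univ ![a - a', b - b', c - c']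
    (by simp [Fin.sum_univ_three]; linarith)
    (by
      simp only [Fin.sum_univ_three, Matrix.cons_val_zero, Matrix.cons_val_one, Matrix.cons_val]
      rw [← sub_eq_zero] at he
      rw [← he]; module)
  have h0 := key 0 (Finset.mem_univ _)
  have h1 := key 1 (Finset.mem_univ _)
  have h2 := key 2 (Finset.mem_univ _)
  exact ⟨sub_eq_zero.1 h0, sub_eq_zero.1 h1, sub_eq_zero.1 h2⟩

theorem exists_not_collinear {S W : Type*} [AddCommGroup W] [Module ℝ W] {p : S → W}
    (hp : ¬ Collinear ℝ (Set.range p)) {x y : W} (hxy : x ≠ y) :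
    ∃ u, ¬ Collinear ℝ {x, y, p u} := by
  by_contra! h
  apply hp
  refine Collinear.subset (s₂ := (line[ℝ, x, y] : Set W)) ?_ ?_
  · rintro _ ⟨u, rfl⟩
    exact (h u).mem_affineSpan_of_mem_of_ne (by simp) (by simp) (by simp) hxy
  · rw [Collinear, ← direction_affineSpan, AffineSubspace.affineSpan_coe, direction_affineSpan]
    exact collinear_pair ℝ x y

theorem exists_apply_ne {S W : Type*} [AddCommGroup W] [Module ℝ W] {p : S → W}
    (hp : ¬ Collinear ℝ (Set.range p)) (x : W) : ∃ u, x ≠ p u := by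
  by_contra! h
  refine hp ((collinear_singleton ℝ x).subset ?_)
  rintro _ ⟨u, rfl⟩
  exact (h u).symm

/-! ### Weight ratios -/

/-- `m s t` is the ratio of the weights in a representation of `p (s + t)` as a strict convex
combination of `p s` and `p t`: the weight of `p t` divided by the weight of `p s`. When
`p s = p t` this leaves `m s t` an arbitrary positive number. -/
structure IsWeightRatio {S W : Type*} [AddCommSemigroup S] [AddCommGroup W] [Module ℝ W]
    (p : S → W) (m : S → S → ℝ) : Prop where
  pos : ∀ s t, 0 < m s t
  smul_apply_add : ∀ s t, (1 + m s t) • p (s + t) = p s + m s t • p t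

theorem exists_isWeightRatio {S W : Type*} [AddCommSemigroup S] [AddCommGroup W] [Module ℝ W]
    {p : S → W} (h : ∀ s t, p (s + t) ∈ openSegment ℝ (p s) (p t)) :
    ∃ m, IsWeightRatio p m := by
  choose a b ha hb hab he using h
  refine ⟨fun s t => b s t / a s t, fun s t => div_pos (hb s t) (ha s t), fun s t => ?_⟩
  have h1 := ha s t
  have h2 := hab s t
  rw [← he s t, smul_add, smul_smul, smul_smul,
    show 1 + b s t / a s t = (a s t)⁻¹ by field_simp; exact h2]
  congr 1
  · rw [inv_mul_cancel₀ h1.ne', one_smul]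
  · congr 1; field_simp

namespace IsWeightRatio

variable {S W : Type*} [AddCommSemigroup S] [AddCommGroup W] [Module ℝ W] {p : S → W}
  {m : S → S → ℝ}

theorem apply_add (hm : IsWeightRatio p m) (s t : S) :
    p (s + t) = (1 / (1 + m s t)) • p s + (m s t / (1 + m s t)) • p t := by
  have h0 : 1 + m s t ≠ 0 := by have := hm.pos s t; positivity
  rw [← inv_smul_smul₀ h0 (p (s + t)), hm.smul_apply_add]
  simp only [smul_add, smul_smul]
  congr 2 <;> field_simp

theorem wbtw_add (hm : IsWeightRatio p m) (s t : S) : Wbtw ℝ (p s) (p (s + t)) (p t) := by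
  have h0 := hm.pos s t
  rw [← mem_segment_iff_wbtw, hm.apply_add]
  exact ⟨_, _, by positivity, by positivity, by field_simp, rfl⟩

/-- Weights of `p (s + t + u)` read off from the bracketing `(s + t) + u`. -/
theorem exists_weights (hm : IsWeightRatio p m) (s t u : S) :
    ∃ a b c : ℝ, 0 < a ∧ a + b + c = 1 ∧ p (s + t + u) = a • p s + b • p t + c • p u ∧
      b = m s t * a := by
  have h1 := hm.pos s t
  have h2 := hm.pos (s + t) u
  refine ⟨1 / ((1 + m (s + t) u) * (1 + m s t)), m s t / ((1 + m (s + t) u) * (1 + m s t)),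
    m (s + t) u / (1 + m (s + t) u), by positivity, by field_simp, ?_, by field_simp⟩
  rw [hm.apply_add (s + t) u, hm.apply_add s t]
  match_scalars <;> field_simp

/-- Weights of `p (s + t + u)` read off from the bracketing `s + (t + u)`. -/
theorem exists_weights_add_right (hm : IsWeightRatio p m) (s t u : S) :
    ∃ a b c : ℝ, a + b + c = 1 ∧ p (s + t + u) = a • p s + b • p t + c • p u ∧
      b + c = m s (t + u) * a := by
  have h1 := hm.pos s (t + u)
  have h2 := hm.pos t u
  refine ⟨1 / (1 + m s (t + u)), m s (t + u) / ((1 + m s (t + u)) * (1 + m t u)),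
    m s (t + u) * m t u / ((1 + m s (t + u)) * (1 + m t u)), by field_simp; ring, ?_,
    by field_simp⟩
  rw [add_assoc, hm.apply_add s (t + u), hm.apply_add t u]
  match_scalars <;> field_simp

theorem mul_symm (hm : IsWeightRatio p m) {s t : S} (h : p s ≠ p t) :
    m s t * m t s = 1 := by
  have h1 := hm.pos s t
  have h2 := hm.pos t s
  have e := hm.apply_add s t
  rw [add_comm s t, hm.apply_add t s, ← sub_eq_zero] at e
  have e' : (m t s / (1 + m t s) - 1 / (1 + m s t)) • (p s - p t) = 0 := by
    rw [← e]
    match_scalars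
    · field_simp
    · field_simp
      ring
  rcases smul_eq_zero.1 e' with e' | e'
  · field_simp at e'
    linarith
  · exact absurd (sub_eq_zero.1 e') h

/-- The cocycle identity and additivity of the weight ratio at a non-collinear triple: both express
that the barycentric coordinates of `p (s + t + u)` do not depend on the bracketing. -/
theorem mul_eq_and_add_eq (hm : IsWeightRatio p m) {s t u : S}
    (h : ¬ Collinear ℝ {p s, p t, p u}) :
    m s t * m t u = m s u ∧ m s (t + u) = m s t + m s u := by
  obtain ⟨a, b, c, ha, hs, hx, hb⟩ := hm.exists_weights s t u
  obtain ⟨b₁, c₁, a₁, -, hs₁, hx₁, hb₁⟩ := hm.exists_weights t u s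
  obtain ⟨a₂, c₂, b₂, -, hs₂, hx₂, hb₂⟩ := hm.exists_weights s u t
  obtain ⟨a₃, b₃, c₃, hs₃, hx₃, hb₃⟩ := hm.exists_weights_add_right s t u
  rw [show t + u + s = s + t + u by rw [add_comm, add_assoc], hx] at hx₁
  rw [show s + u + t = s + t + u by rw [add_right_comm], hx] at hx₂
  rw [hx] at hx₃
  obtain ⟨rfl, rfl, rfl⟩ := eq_of_weights_eq h (a' := a₁) (b' := b₁) (c' := c₁) hs
    (by linarith) (by rw [hx₁]; abel)
  obtain ⟨rfl, rfl, rfl⟩ := eq_of_weights_eq h (a' := a₂) (b' := b₂) (c' := c₂) hs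
    (by linarith) (by rw [hx₂]; abel)
  obtain ⟨rfl, rfl, rfl⟩ := eq_of_weights_eq h hs hs₃ hx₃
  constructor <;> apply mul_right_cancel₀ ha.ne'
  · rw [← hb₂, hb₁, hb]; ring
  · rw [← hb₃, add_mul, ← hb, ← hb₂]

/-- The cocycle identity at any three distinct points of the image. In the collinear case it follows
by passing through a point off the line. -/
theorem mul_eq (hm : IsWeightRatio p m) (hp : ¬ Collinear ℝ (Set.range p)) {s t u : S}
    (hst : p s ≠ p t) (htu : p t ≠ p u) (hsu : p s ≠ p u) : m s t * m t u = m s u := by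
  by_cases h : Collinear ℝ {p s, p t, p u}
  swap
  · exact (hm.mul_eq_and_add_eq h).1
  obtain ⟨v, hv⟩ := exists_not_collinear hp hst
  have off : ∀ {x y : S}, p x ≠ p y → p x ∈ ({p s, p t, p u} : Set W) →
      p y ∈ ({p s, p t, p u} : Set W) → m x v * m v y = m x y := by
    intro x y hxy hx hy
    refine (hm.mul_eq_and_add_eq fun hc => hv ?_).1
    have hline : ∀ w ∈ ({p s, p t, p u} : Set W), w ∈ line[ℝ, p x, p y] := fun w hw =>
      h.mem_affineSpan_of_mem_of_ne hx hy hw hxy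
    have hvl : p v ∈ line[ℝ, p x, p y] :=
      hc.mem_affineSpan_of_mem_of_ne (by simp) (by simp) (by simp) hxy
    exact collinear_triple_of_mem_affineSpan_pair (hline _ (by simp)) (hline _ (by simp)) hvl
  have hvt : p t ≠ p v := ne₂₃_of_not_collinear hv
  rw [← off hst (by simp) (by simp), ← off htu (by simp) (by simp),
    ← off hsu (by simp) (by simp)]
  linear_combination m s v * m v u * hm.mul_symm hvt

/-- The cocycle `m` is a coboundary: `m s t = c t / c s` wherever `m s t` is determined by `p`. -/
theorem exists_potential (hm : IsWeightRatio p m) (hp : ¬ Collinear ℝ (Set.range p)) :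
    ∃ c : S → ℝ, (∀ s, 0 < c s) ∧ ∀ s t, p s ≠ p t → c t = c s * m s t := by
  classical
  obtain ⟨e, -⟩ := exists_apply_ne hp 0
  obtain ⟨e', he⟩ := exists_apply_ne hp (p e)
  -- The value `c s` is `m e s`, except that `m e s` carries no information when `p s = p e`; there
  -- the detour over `e'` replaces it, and `key` says that the two prescriptions are compatible.
  have key : ∀ s t, p s = p e → p t ≠ p e → m e t = m e e' * m e' s * m s t := by
    intro s t hs ht
    by_cases hte : p t = p e'
    -- The images of `e, e', s, t` are only two points: compare through `u` off their line.
    · obtain ⟨u, hu⟩ := exists_not_collinear hp he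
      have h1 : p e ≠ p u := ne₁₃_of_not_collinear hu
      have h2 : p e' ≠ p u := ne₂₃_of_not_collinear hu
      have h3 : p s ≠ p u := hs ▸ h1
      have h4 : p t ≠ p u := hte ▸ h2
      have h5 : p e' ≠ p s := hs ▸ he.symm
      have h6 : p s ≠ p t := hs ▸ ht.symm
      rw [← hm.mul_eq hp h1 h2.symm he, ← hm.mul_eq hp h2 h3.symm h5,
        ← hm.mul_eq hp h3 h4.symm h6, ← hm.mul_eq hp h1 h4.symm ht.symm]
      have e1 := hm.mul_symm h2
      have e2 := hm.mul_symm h3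
      linear_combination (-m e u * m u t) * e1 - (m e u * m u t * m u e' * m e' u) * e2
    · rw [mul_assoc, hm.mul_eq hp (hs ▸ he.symm) (hs ▸ ht.symm) (Ne.symm hte),
        hm.mul_eq hp he (Ne.symm hte) ht.symm]
  refine ⟨fun s => if p s = p e then m e e' * m e' s else m e s, fun s => ?_, fun s t hst => ?_⟩
  · have h1 := hm.pos e e'
    have h2 := hm.pos e' s
    have h3 := hm.pos e s
    dsimp only
    split_ifs <;> positivity
  · dsimp only
    split_ifs with ht hs hs
    · exact absurd (hs.trans ht.symm) hst
    · rw [key t s ht hs, mul_assoc, hm.mul_symm hst.symm, mul_one]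
    · exact key s t hs ht
    · exact (hm.mul_eq hp (Ne.symm hs) hst (Ne.symm ht)).symm

theorem apply_add_eq (hm : IsWeightRatio p m) {s t : S} (h : p s = p t) : p (s + t) = p s := by
  have h1 := hm.pos s t
  rw [hm.apply_add, ← h, ← add_smul]
  convert one_smul ℝ (p s)
  field_simp

theorem apply_add_ne (hm : IsWeightRatio p m) {s t : S} (h : p s ≠ p t) : p s ≠ p (s + t) := by
  intro e
  have h1 := hm.pos s t
  have e2 := hm.smul_apply_add s t
  rw [← e, add_smul, one_smul, add_right_inj] at e2
  exact h (smul_right_injective W h1.ne' e2)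

/-- The points `p s` lift to an additive map `s ↦ c s • (1, p s)`. -/
theorem exists_additive_weight (hm : IsWeightRatio p m) (hp : ¬ Collinear ℝ (Set.range p)) :
    ∃ c : S → ℝ, (∀ s, 0 < c s) ∧ (∀ s t, c (s + t) = c s + c t) ∧
      ∀ s t, c (s + t) • p (s + t) = c s • p s + c t • p t := by
  obtain ⟨c, hc0, hc⟩ := hm.exists_potential hp
  have add_ne : ∀ s t, p s ≠ p t → c (s + t) = c s + c t := by
    intro s t hst
    obtain ⟨u, hu⟩ := exists_not_collinear hp hst
    have hu' : ¬ Collinear ℝ {p u, p s, p t} := by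
      rwa [Set.insert_comm, Set.pair_comm (p u)]
    have hne : p u ≠ p (s + t) := by
      intro e
      have h := (hm.wbtw_add s t).collinear
      rw [← e] at h
      exact hu (by rwa [Set.pair_comm] at h)
    rw [hc u (s + t) hne, (hm.mul_eq_and_add_eq hu').2, mul_add,
      ← hc u s (ne₁₂_of_not_collinear hu'), ← hc u t (ne₁₃_of_not_collinear hu')]
  have add : ∀ s t, c (s + t) = c s + c t := by
    intro s t
    by_cases hst : p s = p t
    swap
    · exact add_ne s t hst
    obtain ⟨u, hu⟩ := exists_apply_ne hp (p t)
    -- Compute `c (s + t + u)` with both bracketings; all the pairs involved have distinct images.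
    have h1 := add_ne (s + t) u (by rwa [hm.apply_add_eq hst, hst])
    rw [add_assoc, add_ne s (t + u) (hst ▸ hm.apply_add_ne hu), add_ne t u hu] at h1
    linarith
  refine ⟨c, hc0, add, fun s t => ?_⟩
  by_cases hst : p s = p t
  · rw [hm.apply_add_eq hst, ← hst, add, add_smul]
  · rw [add, hc s t hst, show c s + c s * m s t = c s * (1 + m s t) by ring, mul_smul,
      hm.smul_apply_add, smul_add, smul_smul]

end IsWeightRatio

/-! ### Additive maps on convex cones -/

/-- A positive additive function on the positive reals is linear: it is strictly increasing, and
linear at the rational points. -/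
theorem eq_mul_of_pos_of_add {φ : ℝ → ℝ} (h0 : ∀ r, 0 < r → 0 < φ r)
    (hadd : ∀ r s, 0 < r → 0 < s → φ (r + s) = φ r + φ s) {r : ℝ} (hr : 0 < r) :
    φ r = r * φ 1 := by
  have hmono : ∀ a b, 0 < a → a < b → φ a < φ b := by
    intro a b ha hab
    have := hadd a (b - a) ha (sub_pos.2 hab)
    rw [add_sub_cancel] at this
    have := h0 (b - a) (sub_pos.2 hab)
    linarith
  have hnat : ∀ (n : ℕ) (a : ℝ), 0 < a → φ ((n + 1 : ℕ) * a) = (n + 1 : ℕ) * φ a := by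
    intro n a ha
    induction n with
    | zero => simp
    | succ k ih =>
      have := hadd ((k + 1 : ℕ) * a) a (by positivity) ha
      rw [ih] at this
      rw [show ((k + 1 + 1 : ℕ) : ℝ) * a = (k + 1 : ℕ) * a + a by push_cast; ring, this]
      push_cast; ring
  have hnat' : ∀ (n : ℕ) (a : ℝ), 0 < n → 0 < a → φ (n * a) = n * φ a := by
    intro n a hn ha
    obtain ⟨k, rfl⟩ := Nat.exists_eq_succ_of_ne_zero hn.ne'
    exact hnat k a ha
  have hrat : ∀ q : ℚ, 0 < q → φ q = q * φ 1 := by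
    intro q hq
    have hd : (0 : ℝ) < q.den := by exact_mod_cast q.den_pos
    have hq' : (0 : ℝ) < q := by exact_mod_cast hq
    have e1 := hnat' q.den q q.den_pos hq'
    have hn : (q.num.toNat : ℝ) = q.den * q := by
      have h1 : ((q.num.toNat : ℤ) : ℝ) = (q.num : ℝ) := by
        rw [Int.toNat_of_nonneg (Rat.num_nonneg.2 hq.le)]
      have h2 : (q.den * q : ℚ) = q.num := Rat.den_mul_eq_num q
      rw [← Int.cast_natCast, h1]
      exact_mod_cast h2.symm
    have e2 := hnat' q.num.toNat 1 (by
      have := Rat.num_pos.2 hq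
      omega) one_pos
    rw [mul_one, hn, e1] at e2
    exact mul_left_cancel₀ hd.ne' (by rw [e2]; ring)
  have h1 := h0 1 one_pos
  rcases lt_trichotomy (φ r) (r * φ 1) with h | h | h
  · obtain ⟨q, hq1, hq2⟩ := exists_rat_btwn ((div_lt_iff₀ h1).2 h)
    have hq0 : (0 : ℝ) < q := lt_trans (div_pos (h0 r hr) h1) hq1
    have := hmono q r hq0 hq2
    rw [hrat q (by exact_mod_cast hq0)] at this
    rw [div_lt_iff₀ h1] at hq1
    linarith
  · exact h
  · obtain ⟨q, hq1, hq2⟩ := exists_rat_btwn ((lt_div_iff₀ h1).2 h)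
    have := hmono r q hr hq1
    rw [hrat q (by exact_mod_cast hr.trans hq1)] at this
    rw [lt_div_iff₀ h1] at hq2
    linarith

/-- An additive, positively homogeneous map on a convex cone containing an order unit `o` extends to
a linear map of the whole space. -/
theorem exists_linear_extension {V W : Type*} [AddCommGroup V] [Module ℝ V] [AddCommGroup W]
    [Module ℝ W] {D : Set V} (hadd : ∀ x ∈ D, ∀ y ∈ D, x + y ∈ D)
    (hsmul : ∀ r : ℝ, 0 < r → ∀ x ∈ D, r • x ∈ D)
    (hgen : ∃ o ∈ D, ∀ v, ∃ k : ℝ, 0 < k ∧ v + k • o ∈ D) (h : V → W)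
    (had : ∀ x ∈ D, ∀ y ∈ D, h (x + y) = h x + h y)
    (hho : ∀ r : ℝ, 0 < r → ∀ x ∈ D, h (r • x) = r • h x) :
    ∃ L : V →ₗ[ℝ] W, ∀ x ∈ D, L x = h x := by
  obtain ⟨o, ho, hk⟩ := hgen
  choose k hk0 hk using hk
  have hko : ∀ v, k v • o ∈ D := fun v => hsmul _ (hk0 v) _ ho
  -- A difference of two elements of the cone determines the difference of their values.
  have diff : ∀ v, ∀ x ∈ D, ∀ y ∈ D, v = x - y →
      h (v + k v • o) - h (k v • o) = h x - h y := by
    rintro v x hx y hy rfl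
    rw [sub_eq_sub_iff_add_eq_add, ← had _ (hk _) _ hy, ← had _ hx _ (hko _)]
    congr 1; abel
  have addL : ∀ v w, h (v + w + k (v + w) • o) - h (k (v + w) • o) =
      (h (v + k v • o) - h (k v • o)) + (h (w + k w • o) - h (k w • o)) := by
    intro v w
    rw [diff (v + w) ((v + k v • o) + (w + k w • o)) (hadd _ (hk v) _ (hk w))
      (k v • o + k w • o) (hadd _ (hko v) _ (hko w)) (by abel), had _ (hk v) _ (hk w),
      had _ (hko v) _ (hko w)]
    abel
  let A : V →+ W := AddMonoidHom.mk' (fun v => h (v + k v • o) - h (k v • o)) addL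
  have posL : ∀ (r : ℝ) v, 0 < r → A (r • v) = r • A v := by
    intro r v hr
    change h _ - h _ = r • (h _ - h _)
    rw [diff (r • v) (r • (v + k v • o)) (hsmul _ hr _ (hk v)) (r • k v • o)
      (hsmul _ hr _ (hko v)) (by rw [smul_add]; abel), hho _ hr _ (hk v), hho _ hr _ (hko v),
      smul_sub]
  refine ⟨{ toFun := A, map_add' := A.map_add, map_smul' := fun r v => ?_ }, fun x hx => ?_⟩
  · rcases lt_trichotomy r 0 with hr | rfl | hr
    · have := posL (-r) v (neg_pos.2 hr)
      rw [neg_smul, neg_smul, map_neg, neg_inj] at this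
      exact this
    · simp
    · exact posL r v hr
  · change h _ - h _ = h x
    rw [diff x (x + x) (hadd _ hx _ hx) x hx (by abel), had _ hx _ hx, add_sub_cancel_right]

/-! ### The perspective function -/

theorem IsPerspectiveDomain.zero_pos {d : ℕ} {D : Set (Fin (d + 1) → ℝ)}
    (hD : IsPerspectiveDomain D) {s : Fin (d + 1) → ℝ} (hs : s ∈ D) : 0 < s 0 := by
  rcases hD with rfl | rfl
  · exact hs
  · exact hs 0

theorem IsPerspectiveDomain.add_mem {d : ℕ} {D : Set (Fin (d + 1) → ℝ)}
    (hD : IsPerspectiveDomain D) {s t : Fin (d + 1) → ℝ} (hs : s ∈ D) (ht : t ∈ D) :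
    s + t ∈ D := by
  rcases hD with rfl | rfl
  · exact add_pos (α := ℝ) hs ht
  · exact fun i => add_pos (hs i) (ht i)

theorem IsPerspectiveDomain.smul_mem {d : ℕ} {D : Set (Fin (d + 1) → ℝ)}
    (hD : IsPerspectiveDomain D) {r : ℝ} (hr : 0 < r) {s : Fin (d + 1) → ℝ} (hs : s ∈ D) :
    r • s ∈ D := by
  rcases hD with rfl | rfl
  · exact mul_pos (α := ℝ) hr hs
  · exact fun i => mul_pos hr (hs i)

/-- The all-ones vector is an order unit for both kinds of domain. -/
theorem IsPerspectiveDomain.exists_unit {d : ℕ} {D : Set (Fin (d + 1) → ℝ)}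
    (hD : IsPerspectiveDomain D) : ∃ o ∈ D, ∀ v, ∃ k : ℝ, 0 < k ∧ v + k • o ∈ D := by
  have key : ∀ (v : Fin (d + 1) → ℝ) (i : Fin (d + 1)),
      0 < (v + (‖v‖ + 1) • (1 : Fin (d + 1) → ℝ)) i := by
    intro v i
    have h1 := norm_le_pi_norm v i
    have h2 := neg_abs_le (v i)
    rw [Real.norm_eq_abs] at h1
    simp only [Pi.add_apply, Pi.smul_apply, Pi.one_apply, smul_eq_mul, mul_one]
    linarith
  refine ⟨1, ?_, fun v => ⟨‖v‖ + 1, by positivity, ?_⟩⟩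
  · rcases hD with rfl | rfl <;> simp
  · rcases hD with rfl | rfl
    · exact key v 0
    · exact key v

theorem perspective_smul {d : ℕ} {r : ℝ} (hr : r ≠ 0) (s : Fin (d + 1) → ℝ) :
    perspective (r • s) = perspective s := by
  funext i
  simp [perspective, mul_div_mul_left _ _ hr]

theorem perspective_add_mem_openSegment {d : ℕ} {s t : Fin (d + 1) → ℝ} (hs : 0 < s 0)
    (ht : 0 < t 0) : perspective (s + t) ∈ openSegment ℝ (perspective s) (perspective t) := by
  refine ⟨s 0 / (s 0 + t 0), t 0 / (s 0 + t 0), by positivity, by positivity, by field_simp, ?_⟩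
  funext i
  simp only [perspective, Pi.add_apply, Pi.smul_apply, smul_eq_mul]
  field_simp

theorem smul_cons_perspective {d : ℕ} {s : Fin (d + 1) → ℝ} (hs : s 0 ≠ 0) :
    s 0 • (Fin.cons 1 (perspective s) : Fin (d + 1) → ℝ) = s := by
  funext i
  refine Fin.cases ?_ (fun j => ?_) i
  · simp
  · simp [perspective, mul_div_cancel₀ _ hs]

/-! ### Fractional linear maps -/

theorem hasFractionalForm_of_induces {d d' : ℕ} {D : Set (Fin (d + 1) → ℝ)}
    {D' : Set (Fin (d' + 1) → ℝ)} (hD : IsPerspectiveDomain D) (hD' : IsPerspectiveDomain D')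
    {f : D → D'} (hf : ScalarCondition (fun s : D => (f s : Fin (d' + 1) → ℝ)))
    {F : perspective '' D → perspective '' D'} (hF : Induces f F)
    (hconv : StrictInvConvexityPreserving (fun x => (F x : Fin d' → ℝ)))
    (hcol : ¬ Collinear ℝ (Set.range fun x => (F x : Fin d' → ℝ))) :
    HasFractionalForm f := by
  -- The domain as an additive semigroup, on which `p` has a weight ratio.
  let S : AddSubsemigroup (Fin (d + 1) → ℝ) := ⟨D, fun hs ht => hD.add_mem hs ht⟩
  let p : S → (Fin d' → ℝ) := fun s => F ⟨perspective s, Set.mem_image_of_mem perspective s.2⟩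
  have hpr : Set.range p = Set.range fun x => (F x : Fin d' → ℝ) := by
    ext y
    constructor
    · rintro ⟨s, rfl⟩
      exact ⟨_, rfl⟩
    · rintro ⟨⟨_, s, hs, rfl⟩, rfl⟩
      exact ⟨⟨s, hs⟩, rfl⟩
  obtain ⟨m, hm⟩ := exists_isWeightRatio (p := p) fun s t => hconv _ _ _
    (perspective_add_mem_openSegment (hD.zero_pos s.2) (hD.zero_pos t.2))
  obtain ⟨c, hc0, hcadd, hcp⟩ := hm.exists_additive_weight (by rwa [hpr])
  have hpf : ∀ s : D, p s = perspective (f s : Fin (d' + 1) → ℝ) := hF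
  have hps : ∀ (r : ℝ) (hr : 0 < r) (s : S), p ⟨r • s, hD.smul_mem hr s.2⟩ = p s := by
    intro r hr s
    simp only [p, perspective_smul hr.ne']
  have hcs : ∀ (r : ℝ) (hr : 0 < r) (s : S), c ⟨r • s, hD.smul_mem hr s.2⟩ = r * c s := by
    intro r hr s
    have := eq_mul_of_pos_of_add
      (φ := fun r => if hr : 0 < r then c ⟨r • s, hD.smul_mem hr s.2⟩ else 0)
      (fun r hr => by simp only [hr, dif_pos, hc0])
      (fun r r' hr hr' => by
        simp only [hr, hr', add_pos hr hr', dif_pos]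
        rw [← hcadd]
        congr 1
        ext1
        exact add_smul r r' (s : Fin (d + 1) → ℝ)) hr
    simpa [hr] using this
  -- The lift of `p` to homogeneous coordinates; only its values on `D` matter.
  let h : (Fin (d + 1) → ℝ) → (Fin (d' + 1) → ℝ) := open Classical in fun s =>
    if hs : s ∈ D then c ⟨s, hs⟩ • (Fin.cons 1 (p ⟨s, hs⟩)) else 0
  have hh : ∀ s (hs : s ∈ D), h s = c ⟨s, hs⟩ • (Fin.cons 1 (p ⟨s, hs⟩)) := fun s hs =>
    dif_pos hs
  obtain ⟨L, hL⟩ := exists_linear_extension (fun x hx y hy => hD.add_mem hx hy)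
    (fun r hr x hx => hD.smul_mem hr hx) hD.exists_unit h
    (fun x hx y hy => by
      rw [hh x hx, hh y hy, hh _ (hD.add_mem hx hy)]
      have e1 := hcadd ⟨x, hx⟩ ⟨y, hy⟩
      have e2 := hcp ⟨x, hx⟩ ⟨y, hy⟩
      funext i
      refine Fin.cases ?_ (fun j => ?_) i
      · simpa using! e1
      · simpa using! congrFun e2 j)
    (fun r hr x hx => by
      rw [hh x hx, hh _ (hD.smul_mem hr hx), hps r hr ⟨x, hx⟩, hcs r hr ⟨x, hx⟩, mul_smul])
  have hL' : ∀ s : D, L s = c s • (Fin.cons 1 (p s) : Fin (d' + 1) → ℝ) := fun s => by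
    rw [hL s s.2, hh s s.2]
    rfl
  have hL0 : ∀ s : D, L s 0 = c s := fun s => by simp [hL']
  refine ⟨L, fun s t r hr hst => ?_, fun s => hD'.zero_pos (f s).2, fun s => ?_, fun s => ?_⟩
  · obtain ⟨μ, hμ, e⟩ := hf s t r hr hst
    exact ⟨μ, hμ, congrFun e 0⟩
  · rw [hL0]; exact hc0 s
  · rw [hL0, hL', smul_smul, div_mul_cancel₀ _ (hc0 s).ne', hpf,
      smul_cons_perspective (hD'.zero_pos (f s).2).ne']

theorem exists_induced_of_hasFractionalForm {d d' : ℕ} {D : Set (Fin (d + 1) → ℝ)}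
    {D' : Set (Fin (d' + 1) → ℝ)} (hD : IsPerspectiveDomain D) {f : D → D'}
    (hf : HasFractionalForm f) :
    ∃ F : perspective '' D → perspective '' D', Induces f F ∧
      StrictInvConvexityPreserving (fun x => (F x : Fin d' → ℝ)) := by
  obtain ⟨L, -, hf0, hL0, hfL⟩ := hf
  have hpL : ∀ s : D, perspective (f s : Fin (d' + 1) → ℝ) = perspective (L s) := fun s => by
    rw [hfL, perspective_smul (div_pos (hf0 s) (hL0 s)).ne']
  have hwd : ∀ s t : D, perspective (s : Fin (d + 1) → ℝ) = perspective (t : Fin (d + 1) → ℝ) →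
      perspective (L s) = perspective (L t) := by
    intro s t hst
    have hs := hD.zero_pos s.2
    have ht := hD.zero_pos t.2
    rw [← smul_cons_perspective hs.ne', ← smul_cons_perspective ht.ne', map_smul, map_smul,
      perspective_smul hs.ne', perspective_smul ht.ne', hst]
  -- `F` is defined through a choice of preimages, and `hwd` says that the choice is immaterial.
  choose σ hσ hσx using fun x : perspective '' D => x.2
  let F : perspective '' D → perspective '' D' := fun x =>
    ⟨_, Set.mem_image_of_mem perspective (f ⟨σ x, hσ x⟩).2⟩
  have hF : ∀ s : D, (F ⟨perspective s, Set.mem_image_of_mem perspective s.2⟩ : Fin d' → ℝ) =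
      perspective (L s) := fun s =>
    (hpL _).trans (hwd _ _ (hσx ⟨perspective s, Set.mem_image_of_mem perspective s.2⟩))
  refine ⟨F, fun s => (hF s).trans (hpL s).symm, ?_⟩
  rintro ⟨_, s, hs, rfl⟩ ⟨_, t, ht, rfl⟩ ⟨_, u, hu, rfl⟩ ⟨a, b, ha, hb, hab, e⟩
  have hs0 := hD.zero_pos hs
  have ht0 := hD.zero_pos ht
  -- Rescaling turns the convex combination of `X s` and `X t` into a sum of elements of `D`.
  have hs' : (a / s 0) • s ∈ D := hD.smul_mem (div_pos ha hs0) hs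
  have ht' : (b / t 0) • t ∈ D := hD.smul_mem (div_pos hb ht0) ht
  have hw : perspective ((a / s 0) • s + (b / t 0) • t) = perspective u := by
    refine Eq.trans ?_ e
    funext i
    simp only [perspective, Pi.add_apply, Pi.smul_apply, smul_eq_mul]
    field_simp
    rw [hab, mul_one]
  dsimp only
  rw [hF ⟨s, hs⟩, hF ⟨t, ht⟩, hF ⟨u, hu⟩, ← hwd ⟨_, hD.add_mem hs' ht'⟩ ⟨u, hu⟩ hw]
  have key := perspective_add_mem_openSegment (hL0 ⟨_, hs'⟩) (hL0 ⟨_, ht'⟩)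
  simpa only [map_add, map_smul, perspective_smul (div_pos ha hs0).ne',
    perspective_smul (div_pos hb ht0).ne'] using key

theorem mainTheorem2 {d d' : ℕ} (D : Set (Fin (d + 1) → ℝ)) (D' : Set (Fin (d' + 1) → ℝ))
    (hD : IsPerspectiveDomain D) (hD' : IsPerspectiveDomain D') (f : D → D') :
    (ScalarCondition (fun s : D => (f s : Fin (d' + 1) → ℝ)) →
      ∀ F : perspective '' D → perspective '' D', Induces f F →
        StrictInvConvexityPreserving (fun x => (F x : Fin d' → ℝ)) →
        ¬ Collinear ℝ (Set.range fun x => (F x : Fin d' → ℝ)) →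
        HasFractionalForm f) ∧
    (HasFractionalForm f →
      ∃ F : perspective '' D → perspective '' D', Induces f F ∧
        StrictInvConvexityPreserving (fun x => (F x : Fin d' → ℝ))) :=
  ⟨fun hf _ hF hconv hcol => hasFractionalForm_of_induces hD hD' hf hF hconv hcol,
    exists_induced_of_hasFractionalForm hD⟩
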